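/- A similitude of $\mathbb{R}^d$ with similarity ratio $\alpha>0$ is a map $g:\mathbb{R}^d\to\mathbb{R}^d$ with $|g(x)-g(y)|=\alpha|x-y|$ for all $x,y$. Let $K\subset\mathbb{R}^d$ be a nonempty compact set. A presentation of $K$ is a finite family of similitudes $\varphi_1,\dots,\varphi_r$ of $\mathbb{R}^d$, $r\ge 2$, such that $K=\varphi_1(K)\cup\dots\cup\varphi_r(K)$ and the sets $\varphi_i(K)$ are pairwise disjoint; $K$ is self-similar with the strong separation condition if it has a presentation. A Borel probability measure $\mu$ on $K$ is self-similar with respect to this presentation if there are $p_1,\dots,p_r>0$ with $\sum_i p_i=1$ such that $\mu(H)=\sum_{i=1}^r p_i\,\mu(\varphi_i^{-1}(H))$ for every Borel set $H\subset K$. A Borel measure $\mu$ on $K$ is isometry invariant if $\mu(B)=\mu(g(B))$ whenever $g$ is an isometry of $\mathbb{R}^d$, $B\subset K$ is a Borel set and $g(B)\subset K$. The algebraic dependence number of a presentation whose maps have similarity ratios $\alpha_1,\dots,\alpha_r$ is $$\dim_{\mathbb{Q}}\operatorname{span}_{\mathbb{Q}}\{-\log\alpha_1,\dots,-\log\alpha_r\}-1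 .$$ **Theorem.** Let $K\subset\mathbb{R}^d$ be self-similar with the strong separation condition, and let $\{\varphi_1,\dots,\varphi_r\}$ and $\{\psi_1,\dots,\psi_s\}$ be two presentations of $K$. 1. If a measure $\mu$ on $K$ is isometry invariant and self-similar with respect to $\{\varphi_1,\dots,\varphi_r\}$, then $\mu$ is self-similar with respect to $\{\psi_1,\dots,\psi_s\}$. Thus the class of isometry invariant self-similar measures on $K$ is the same for both presentations. 2. The algebraic dependence numbers of $\{\varphi_1,\dots,\varphi_r\}$ and $\{\psi_1,\dots,\psi_s\}$ are equal. -/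

import Mathlib

open MeasureTheory
open scoped NNReal ENNReal

/-- A family of similitudes `φ 0, …, φ (r-1)` of `ℝ^d` (maps with `dist (φ x) (φ y) = α * dist x y`
for some `α > 0`, which is what `→ᵈ` says) is a presentation of `K` if `r ≥ 2` and `K` is the
disjoint union of the images `φ i '' K`. -/
structure IsPresentation {d r : ℕ} (K : Set (EuclideanSpace ℝ (Fin d)))
    (φ : Fin r → (EuclideanSpace ℝ (Fin d) →ᵈ EuclideanSpace ℝ (Fin d))) : Prop where
  two_le : 2 ≤ r
  eq_iUnion : K = ⋃ i, φ i '' K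
  disjoint : Pairwise fun i j => Disjoint (φ i '' K) (φ j '' K)

/-- `μ` is a self-similar measure on `K` with respect to the similitudes `φ`: a Borel probability
measure carried by `K` such that, for some weights `p i > 0` with `∑ p i = 1`, one has
`μ H = ∑ p i * μ (φ i ⁻¹ H)` for every Borel set `H ⊆ K`. -/
structure IsSelfSimilarMeasure {d r : ℕ} (K : Set (EuclideanSpace ℝ (Fin d)))
    (φ : Fin r → (EuclideanSpace ℝ (Fin d) →ᵈ EuclideanSpace ℝ (Fin d)))
    (μ : Measure (EuclideanSpace ℝ (Fin d))) : Prop where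
  measure_univ : μ Set.univ = 1
  measure_compl : μ Kᶜ = 0
  exists_weights : ∃ p : Fin r → ℝ≥0, (∀ i, 0 < p i) ∧ ∑ i, p i = 1 ∧
    ∀ H : Set (EuclideanSpace ℝ (Fin d)), MeasurableSet H → H ⊆ K →
      μ H = ∑ i, (p i : ℝ≥0∞) * μ (φ i ⁻¹' H)

/-- `μ` is isometry invariant on `K`: `μ B = μ (g(B))` for every isometry `g` of `ℝ^d` and every
Borel set `B ⊆ K` with `g(B) ⊆ K`. -/
def IsIsometryInvariantOn {d : ℕ} (K : Set (EuclideanSpace ℝ (Fin d)))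
    (μ : Measure (EuclideanSpace ℝ (Fin d))) : Prop :=
  ∀ g : EuclideanSpace ℝ (Fin d) → EuclideanSpace ℝ (Fin d), Isometry g →
    ∀ B : Set (EuclideanSpace ℝ (Fin d)), MeasurableSet B → B ⊆ K → g '' B ⊆ K →
      μ B = μ (g '' B)

/-- The algebraic dependence number of a family of similitudes with similarity ratios `α i`:
the dimension over `ℚ` of the subspace of `ℝ` generated by the numbers `-log (α i)`, minus one. -/
noncomputable def algebraicDependenceNumber {d r : ℕ}
    (φ : Fin r → (EuclideanSpace ℝ (Fin d) →ᵈ EuclideanSpace ℝ (Fin d))) : ℤ :=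
  (Module.finrank ℚ
    (Submodule.span ℚ (Set.range fun i => -Real.log (Dilation.ratio (φ i) : ℝ))) : ℤ) - 1

open Filter Topology Set Metric

/-! Measures: let `f` be a similitude with `f(K) ⊆ K`. Since `f ∘ φ i` and `φ i ∘ f` have the same
ratio, they differ by an isometry, so invariance gives `μ(f(φ i(S))) = p i * μ(f(S))`. Hence `H ↦
μ(f(H ∩ K))` solves the same self-similarity equation as `μ`, and uniqueness (`measure_ext`) makes
it `μ(f(K)) • μ`. For `f = ψ j` this is self-similarity with weights `μ(ψ j(K))`.

Ratios: let `g n(K)` be a minimal `φ`-cylinder containing `ψ j ^ n(K)`. The pullbacks of `ψ j ^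
n(K)` by `g n` are uniformly separated from the rest of `K`, so compactness allows only finitely
many of them. Two coincide, and comparing diameters expresses a power of the ratio of `ψ j` through
ratios of the `φ i` (`exists_pow_ratio_mul_eq`). By symmetry the two `ℚ`-spans are equal. -/

/-! ### Similitudes of Euclidean space -/

/-- A dilation of a finite-dimensional Euclidean space is surjective. -/
theorem Dilation.surjective_euclideanSpace {d : ℕ}
    (f : EuclideanSpace ℝ (Fin d) →ᵈ EuclideanSpace ℝ (Fin d)) : Function.Surjective f := by
  have hr : (0 : ℝ) < Dilation.ratio f := Dilation.ratio_pos f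
  have hi : Isometry fun x => (Dilation.ratio f : ℝ)⁻¹ • f x := by
    refine Isometry.of_dist_eq fun x y => ?_
    rw [dist_smul₀, Dilation.dist_eq, norm_inv, Real.norm_of_nonneg hr.le]
    field_simp
  intro y
  -- An isometry into a strictly convex space is affine, hence onto by equality of dimensions.
  obtain ⟨x, hx⟩ := (hi.affineIsometryOfStrictConvexSpace.toAffineIsometryEquiv rfl).surjective
    ((Dilation.ratio f : ℝ)⁻¹ • y)
  refine ⟨x, ?_⟩
  rw [AffineIsometry.toAffineIsometryEquiv_apply,
    Isometry.coe_affineIsometryOfStrictConvexSpace] at hx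
  exact smul_right_injective _ (inv_ne_zero hr.ne') hx

/-- Two dilations with the same ratio differ by an isometry of the target. -/
theorem Dilation.exists_isometry_comp_eq {d : ℕ}
    (f g : EuclideanSpace ℝ (Fin d) →ᵈ EuclideanSpace ℝ (Fin d))
    (h : Dilation.ratio f = Dilation.ratio g) :
    ∃ u : EuclideanSpace ℝ (Fin d) → EuclideanSpace ℝ (Fin d), Isometry u ∧ ∀ x, u (f x) = g x := by
  obtain ⟨v, hv⟩ := (Dilation.surjective_euclideanSpace f).hasRightInverse
  refine ⟨fun x => g (v x), Isometry.of_dist_eq fun x y => ?_, fun x => ?_⟩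
  · rw [Dilation.dist_eq, ← h, ← Dilation.dist_eq f, hv, hv]
  · exact congrArg g (Dilation.injective f (hv (f x)))

/-! ### Separation and contraction -/

namespace IsPresentation

variable {d r : ℕ} {K : Set (EuclideanSpace ℝ (Fin d))}
  {φ : Fin r → (EuclideanSpace ℝ (Fin d) →ᵈ EuclideanSpace ℝ (Fin d))}

theorem mapsTo (h : IsPresentation K φ) (i : Fin r) : MapsTo (φ i) K K := by
  intro x hx
  rw [h.eq_iUnion]
  exact mem_iUnion.2 ⟨i, mem_image_of_mem _ hx⟩

theorem exists_preimage (h : IsPresentation K φ) {x : EuclideanSpace ℝ (Fin d)} (hx : x ∈ K) :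
    ∃ i, ∃ y ∈ K, φ i y = x := by
  rw [h.eq_iUnion] at hx
  exact mem_iUnion.1 hx

theorem index_eq (h : IsPresentation K φ) {i j : Fin r} {x y : EuclideanSpace ℝ (Fin d)}
    (hx : x ∈ K) (hy : y ∈ K) (hxy : φ i x = φ j y) : i = j := by
  by_contra hij
  exact disjoint_left.1 (h.disjoint hij) (mem_image_of_mem _ hx) (hxy ▸ mem_image_of_mem _ hy)

/-- The strong separation: distinct pieces of a presentation have positive distance. -/
theorem exists_separation (h : IsPresentation K φ) (hK : IsCompact K) :
    ∃ δ : ℝ, 0 < δ ∧ ∀ i, ∀ x ∈ φ i '' K, ∀ y ∈ K, dist x y < δ → y ∈ φ i '' K := by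
  have hc : ∀ i, IsCompact (φ i '' K) := fun i => hK.image (Dilation.toContinuous (φ i))
  have key : ∀ i j, ∃ δ : ℝ, 0 < δ ∧
      (i ≠ j → ∀ x ∈ φ i '' K, ∀ y ∈ φ j '' K, δ ≤ dist x y) := by
    intro i j
    by_cases hij : i = j
    · exact ⟨1, one_pos, fun hne => (hne hij).elim⟩
    obtain ⟨δ, hδ, hd⟩ := (h.disjoint hij).exists_thickenings (hc i) (hc j).isClosed
    refine ⟨δ, hδ, fun _ x hx y hy => ?_⟩
    by_contra! hlt
    exact disjoint_left.1 hd (mem_thickening_iff.2 ⟨x, hx, by rwa [dist_comm]⟩ :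
      y ∈ thickening δ (φ i '' K)) (self_subset_thickening hδ _ hy)
  choose δ hδ hsep using key
  have : Nonempty (Fin r) := ⟨⟨0, by have := h.two_le; omega⟩⟩
  obtain ⟨p, hp⟩ := Finite.exists_min fun p : Fin r × Fin r => δ p.1 p.2
  refine ⟨δ p.1 p.2, hδ _ _, fun i x hx y hy hlt => ?_⟩
  obtain ⟨j, z, hz, rfl⟩ := h.exists_preimage hy
  by_cases hij : i = j
  · exact hij ▸ mem_image_of_mem _ hz
  · exact absurd (hsep i j hij x hx _ (mem_image_of_mem _ hz)) (by
      have := hp (i, j)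
      simp only at this
      linarith)

/-- If `φ i` did not contract, the orbit under `φ i` of a point of another piece would stay
`δ`-separated, contradicting compactness. -/
theorem ratio_lt_one (h : IsPresentation K φ) (hK : IsCompact K) (hne : K.Nonempty) (i : Fin r) :
    Dilation.ratio (φ i) < 1 := by
  by_contra! hge
  obtain ⟨δ, hδ, hsep⟩ := h.exists_separation hK
  obtain ⟨x, hx⟩ := hne
  have : Nontrivial (Fin r) := Fin.nontrivial_iff_two_le.2 h.two_le
  obtain ⟨j, hj⟩ := exists_ne i
  let u : ℕ → EuclideanSpace ℝ (Fin d) := fun n => (φ i ^ n) (φ j x)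
  have hu : ∀ n, u n ∈ K := by
    intro n
    induction n with
    | zero => exact h.mapsTo j hx
    | succ n ih =>
      have : u (n + 1) = φ i (u n) := by simp [u, pow_succ']
      exact this ▸ h.mapsTo i ih
  have hdist : ∀ m k, δ ≤ dist (u m) (u (m + (k + 1))) := by
    intro m k
    have e1 : u (m + (k + 1)) = (φ i ^ m) (u (k + 1)) := by simp [u, pow_add]
    have e2 : u (k + 1) = φ i (u k) := by simp [u, pow_succ']
    rw [e1, Dilation.dist_eq, Dilation.ratio_pow]
    have h1 : (1 : ℝ) ≤ ((Dilation.ratio (φ i) ^ m : ℝ≥0) : ℝ) := by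
      exact_mod_cast one_le_pow₀ hge
    have h2 : δ ≤ dist (φ j x) (u (k + 1)) := by
      by_contra! hlt
      rw [dist_comm] at hlt
      obtain ⟨z, hz, hzx⟩ := hsep i (u (k + 1)) (e2 ▸ mem_image_of_mem _ (hu k)) _
        (h.mapsTo j hx) hlt
      exact hj (h.index_eq hz hx hzx).symm
    nlinarith
  obtain ⟨a, -, θ, hθ, hlim⟩ := hK.tendsto_subseq hu
  obtain ⟨N, hN⟩ := Metric.cauchySeq_iff'.1 hlim.cauchySeq δ hδ
  obtain ⟨k, hk⟩ := Nat.exists_eq_add_of_lt (hθ (Nat.lt_succ_self N))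
  have h1 := hN (N + 1) (Nat.le_succ N)
  have h2 := hdist (θ N) k
  simp only [Function.comp, Nat.succ_eq_add_one] at h1 hk
  rw [hk, dist_comm] at h1
  rw [← add_assoc] at h2
  linarith

theorem exists_ratio_le (h : IsPresentation K φ) (hK : IsCompact K) (hne : K.Nonempty) :
    ∃ a : ℝ, 0 < a ∧ a < 1 ∧ ∀ i, (Dilation.ratio (φ i) : ℝ) ≤ a := by
  have : Nonempty (Fin r) := ⟨⟨0, by have := h.two_le; omega⟩⟩
  obtain ⟨i, hi⟩ := Finite.exists_max fun i => (Dilation.ratio (φ i) : ℝ)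
  exact ⟨_, NNReal.coe_pos.2 (Dilation.ratio_pos _), NNReal.coe_lt_one.2 (h.ratio_lt_one hK hne i),
    hi⟩

theorem diam_pos (h : IsPresentation K φ) (hK : IsCompact K) (hne : K.Nonempty) :
    0 < Metric.diam K := by
  obtain ⟨x, hx⟩ := hne
  have hr := h.two_le
  refine lt_of_lt_of_le (dist_pos.2 fun he => ?_) (dist_le_diam_of_mem hK.isBounded
    (h.mapsTo ⟨0, by omega⟩ hx) (h.mapsTo ⟨1, by omega⟩ hx))
  have := h.index_eq hx hx he
  simp at this

/-! ### Self-similar measures: uniqueness and positivity -/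

/-- The self-similarity equation, for sets that need not lie in `K`. -/
theorem measure_eq_sum (h : IsPresentation K φ) (hK : IsCompact K)
    {μ : Measure (EuclideanSpace ℝ (Fin d))} (hμ : μ Kᶜ = 0) {p : Fin r → ℝ≥0}
    (hp : ∀ H : Set (EuclideanSpace ℝ (Fin d)), MeasurableSet H → H ⊆ K →
      μ H = ∑ i, (p i : ℝ≥0∞) * μ (φ i ⁻¹' H))
    {H : Set (EuclideanSpace ℝ (Fin d))} (hH : MeasurableSet H) :
    μ H = ∑ i, (p i : ℝ≥0∞) * μ (φ i ⁻¹' H) := by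
  have hres : ∀ S, μ (S ∩ K) = μ S := fun S =>
    measure_inter_conull' (measure_mono_null (fun x hx => hx.2) hμ)
  rw [← hres H, hp _ (hH.inter hK.measurableSet) inter_subset_right]
  refine Finset.sum_congr rfl fun i _ => ?_
  rw [← hres (φ i ⁻¹' (H ∩ K)), ← hres (φ i ⁻¹' H)]
  congr 2
  ext x
  exact ⟨fun hx => ⟨hx.1.1, hx.2⟩, fun hx => ⟨⟨hx.1, h.mapsTo i hx.2⟩, hx.2⟩⟩

/-- A self-similar measure scales by the weight `p i` under `φ i`. -/
theorem measure_image (h : IsPresentation K φ)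
    {μ : Measure (EuclideanSpace ℝ (Fin d))} (hμ : μ Kᶜ = 0) {p : Fin r → ℝ≥0}
    (hp : ∀ H : Set (EuclideanSpace ℝ (Fin d)), MeasurableSet H → H ⊆ K →
      μ H = ∑ i, (p i : ℝ≥0∞) * μ (φ i ⁻¹' H))
    (i : Fin r) {H : Set (EuclideanSpace ℝ (Fin d))} (hH : MeasurableSet H) (hHK : H ⊆ K) :
    μ (φ i '' H) = p i * μ H := by
  have hme := (Dilation.isClosedEmbedding (φ i)).measurableEmbedding
  rw [hp _ (hme.measurableSet_image.2 hH) ((image_mono hHK).trans (h.mapsTo i).image_subset),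
    Finset.sum_eq_single i]
  · rw [(Dilation.injective (φ i)).preimage_image]
  · intro j _ hj
    rw [measure_mono_null (fun x hx hxK => ?_) hμ, mul_zero]
    obtain ⟨y, hy, hyx⟩ := hx
    exact hj (h.index_eq (hHK hy) hxK hyx).symm
  · simp

/-- A Lévy–Prokhorov estimate. At scale above `diam K` only total masses matter; each use of the
self-similarity equation improves the scale by the factor `a`. -/
theorem measure_le_thickening (hK : IsCompact K)
    {μ ν : Measure (EuclideanSpace ℝ (Fin d))} (hμ : μ Kᶜ = 0) (hν : ν Kᶜ = 0)
    (huniv : ν univ ≤ μ univ) {p : Fin r → ℝ≥0}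
    (hμp : ∀ H : Set (EuclideanSpace ℝ (Fin d)), MeasurableSet H →
      μ H = ∑ i, (p i : ℝ≥0∞) * μ (φ i ⁻¹' H))
    (hνp : ∀ H : Set (EuclideanSpace ℝ (Fin d)), MeasurableSet H →
      ν H = ∑ i, (p i : ℝ≥0∞) * ν (φ i ⁻¹' H))
    {a : ℝ} (ha : 0 < a) (hφa : ∀ i, (Dilation.ratio (φ i) : ℝ) ≤ a) (n : ℕ) :
    ∀ F, MeasurableSet F → ∀ ε, a ^ n * Metric.diam K < ε → ν F ≤ μ (thickening ε F) := by
  induction n with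
  | zero =>
    intro F _ ε hε
    by_cases hF : (F ∩ K).Nonempty
    · obtain ⟨z, hzF, hzK⟩ := hF
      have hsub : K ⊆ thickening ε F := fun x hx => mem_thickening_iff.2 ⟨z, hzF,
        (dist_le_diam_of_mem hK.isBounded hx hzK).trans_lt (by simpa using hε)⟩
      calc ν F ≤ ν univ := measure_mono (subset_univ F)
        _ ≤ μ univ := huniv
        _ = μ K := by rw [← measure_add_measure_compl hK.measurableSet, hμ, add_zero]
        _ ≤ _ := measure_mono hsub
    · rw [measure_mono_null (fun x hx hxK => hF ⟨x, hx, hxK⟩) hν]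
      exact zero_le
  | succ n ih =>
    intro F hF ε hε
    rw [hνp F hF, hμp _ isOpen_thickening.measurableSet]
    refine Finset.sum_le_sum fun i _ => mul_le_mul_right ?_ _
    have hφi := Dilation.toContinuous (φ i)
    refine (ih _ (hφi.measurable hF) (ε / a) ?_).trans (measure_mono fun x hx => ?_)
    · rw [lt_div_iff₀ ha]
      calc _ = a ^ (n + 1) * Metric.diam K := by ring
        _ < ε := hε
    · obtain ⟨z, hz, hxz⟩ := mem_thickening_iff.1 hx
      rw [mem_preimage, mem_thickening_iff]
      refine ⟨φ i z, hz, ?_⟩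
      rw [lt_div_iff₀ ha] at hxz
      calc dist (φ i x) (φ i z) = Dilation.ratio (φ i) * dist x z := Dilation.dist_eq _ _ _
        _ ≤ dist x z * a := by
          rw [mul_comm]
          exact mul_le_mul_of_nonneg_left (hφa i) dist_nonneg
        _ < ε := hxz

/-- Uniqueness of the self-similar measure with given weights and given total mass. -/
theorem measure_ext (h : IsPresentation K φ) (hK : IsCompact K) (hne : K.Nonempty)
    {μ ν : Measure (EuclideanSpace ℝ (Fin d))} [IsFiniteMeasure μ] [IsFiniteMeasure ν]
    (hμ : μ Kᶜ = 0) (hν : ν Kᶜ = 0) (huniv : ν univ = μ univ) {p : Fin r → ℝ≥0}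
    (hμp : ∀ H : Set (EuclideanSpace ℝ (Fin d)), MeasurableSet H →
      μ H = ∑ i, (p i : ℝ≥0∞) * μ (φ i ⁻¹' H))
    (hνp : ∀ H : Set (EuclideanSpace ℝ (Fin d)), MeasurableSet H →
      ν H = ∑ i, (p i : ℝ≥0∞) * ν (φ i ⁻¹' H)) :
    ν = μ := by
  obtain ⟨a, ha, ha1, hφa⟩ := h.exists_ratio_le hK hne
  -- Let `n → ∞`, then `ε → 0`; both orders of the two measures are needed below.
  have key : ∀ {μ ν : Measure (EuclideanSpace ℝ (Fin d))} [IsFiniteMeasure μ],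
      (∀ n : ℕ, ∀ F, MeasurableSet F → ∀ ε, a ^ n * Metric.diam K < ε → ν F ≤ μ (thickening ε F)) →
      ∀ F, IsClosed F → ν F ≤ μ F := by
    intro μ ν _ hle F hF
    have hlim := tendsto_measure_cthickening_of_isClosed (μ := μ) (s := F)
      ⟨1, one_pos, measure_ne_top _ _⟩ hF
    refine ge_of_tendsto (hlim.mono_left (nhdsWithin_le_nhds (s := Ioi 0))) ?_
    filter_upwards [self_mem_nhdsWithin] with ε hε
    have hpow : Tendsto (fun n : ℕ => a ^ n * Metric.diam K) atTop (𝓝 0) := by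
      simpa using (tendsto_pow_atTop_nhds_zero_of_lt_one ha.le ha1).mul_const (Metric.diam K)
    obtain ⟨n, hn⟩ := (hpow.eventually_lt_const hε).exists
    exact (hle n F hF.measurableSet ε hn).trans (measure_mono (thickening_subset_cthickening _ _))
  refine ext_of_generate_finite _ (BorelSpace.measurable_eq.trans borel_eq_generateFrom_isClosed)
    isPiSystem_isClosed (fun F hF => le_antisymm ?_ ?_) huniv
  · exact key (fun n => measure_le_thickening hK hμ hν huniv.le hμp hνp ha hφa n) F hF
  · exact key (fun n => measure_le_thickening hK hν hμ huniv.ge hνp hμp ha hφa n) F hF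

/-- `φ i` maps a ball about `y` into the ball about `φ i y` with radius `a` times as large. This
later yields positivity of the new weights. -/
theorem measure_closedBall_pos (h : IsPresentation K φ) (hK : IsCompact K)
    {μ : Measure (EuclideanSpace ℝ (Fin d))} (hμ : μ Kᶜ = 0) (hμ0 : μ univ ≠ 0) {p : Fin r → ℝ≥0}
    (hp0 : ∀ i, 0 < p i)
    (hμp : ∀ H : Set (EuclideanSpace ℝ (Fin d)), MeasurableSet H →
      μ H = ∑ i, (p i : ℝ≥0∞) * μ (φ i ⁻¹' H))
    {a : ℝ} (hφa : ∀ i, (Dilation.ratio (φ i) : ℝ) ≤ a) (n : ℕ) :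
    ∀ x ∈ K, 0 < μ (closedBall x (a ^ n * Metric.diam K)) := by
  induction n with
  | zero =>
    intro x hx
    refine lt_of_lt_of_le (pos_iff_ne_zero.2 hμ0) ?_
    calc μ univ = μ K := by rw [← measure_add_measure_compl hK.measurableSet, hμ, add_zero]
      _ ≤ _ := measure_mono fun y hy => by
        simpa using dist_le_diam_of_mem hK.isBounded hy hx
  | succ n ih =>
    intro x hx
    obtain ⟨i, y, hy, rfl⟩ := h.exists_preimage hx
    rw [hμp _ measurableSet_closedBall]
    refine lt_of_lt_of_le ?_ (Finset.single_le_sum (fun _ _ => zero_le) (Finset.mem_univ i))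
    refine ENNReal.mul_pos (by exact_mod_cast (hp0 i).ne')
      ((ih y hy).trans_le (measure_mono fun z hz => ?_)).ne'
    rw [mem_closedBall] at hz
    rw [mem_preimage, mem_closedBall, Dilation.dist_eq, pow_succ]
    have := hφa i
    have ha : 0 ≤ a := (NNReal.coe_nonneg _).trans this
    calc _ ≤ a * (a ^ n * Metric.diam K) := by gcongr
      _ = _ := by ring

/-! ### Change of presentation for invariant measures -/

/-- The image of `μ` under the inverse of a similitude mapping `K` into itself is a multiple of `μ`,
if `μ` is self-similar and isometry invariant. -/
theorem measure_image_of_isIsometryInvariantOn (h : IsPresentation K φ) (hK : IsCompact K)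
    (hne : K.Nonempty) {μ : Measure (EuclideanSpace ℝ (Fin d))} (hinv : IsIsometryInvariantOn K μ)
    (hμ1 : μ univ = 1) (hμ : μ Kᶜ = 0) {p : Fin r → ℝ≥0}
    (hp : ∀ H : Set (EuclideanSpace ℝ (Fin d)), MeasurableSet H → H ⊆ K →
      μ H = ∑ i, (p i : ℝ≥0∞) * μ (φ i ⁻¹' H))
    (f : EuclideanSpace ℝ (Fin d) →ᵈ EuclideanSpace ℝ (Fin d)) (hf : MapsTo f K K)
    {H : Set (EuclideanSpace ℝ (Fin d))} (hH : MeasurableSet H) :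
    μ (f '' (H ∩ K)) = μ (f '' K) * μ H := by
  have : IsProbabilityMeasure μ := ⟨hμ1⟩
  have hme := fun g : EuclideanSpace ℝ (Fin d) →ᵈ EuclideanSpace ℝ (Fin d) =>
    (Dilation.isClosedEmbedding g).measurableEmbedding
  have hcomap : ∀ H, MeasurableSet H → ((μ.comap f).restrict K) H = μ (f '' (H ∩ K)) :=
    fun H hH => by rw [Measure.restrict_apply hH, (hme f).comap_apply]
  have hcomm : ∀ i, ∀ S, MeasurableSet S → S ⊆ K → μ (f '' (φ i '' S)) = p i * μ (f '' S) := by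
    intro i S hS hSK
    have hfS : f '' S ⊆ K := (image_mono hSK).trans hf.image_subset
    have hφS : φ i '' S ⊆ K := (image_mono hSK).trans (h.mapsTo i).image_subset
    obtain ⟨u, hu, hufg⟩ := Dilation.exists_isometry_comp_eq (f * φ i) (φ i * f)
      (by rw [Dilation.ratio_mul, Dilation.ratio_mul, mul_comm])
    have himg : u '' (f '' (φ i '' S)) = φ i '' (f '' S) := by
      simp only [image_image]
      exact image_congr fun x _ => hufg x
    rw [hinv u hu _ ((hme f).measurableSet_image.2 ((hme (φ i)).measurableSet_image.2 hS))
      ((image_mono hφS).trans hf.image_subset)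
      (himg ▸ (image_mono hfS).trans (h.mapsTo i).image_subset), himg]
    exact h.measure_image hμ hp i ((hme f).measurableSet_image.2 hS) hfS
  have : IsFiniteMeasure ((μ.comap f).restrict K) := ⟨by
    rw [hcomap _ .univ]; exact measure_lt_top _ _⟩
  have hfin : IsFiniteMeasure (μ (f '' K) • μ) := ⟨by
    simp only [Measure.smul_apply, hμ1, smul_eq_mul, mul_one]; exact measure_lt_top _ _⟩
  have heq : (μ.comap f).restrict K = μ (f '' K) • μ := by
    refine h.measure_ext hK hne (p := p) (by simp [hμ]) ?_ ?_ ?_ ?_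
    · rw [hcomap _ hK.measurableSet.compl]; simp
    · rw [hcomap _ .univ]; simp [hμ1]
    · intro H hH
      simp only [Measure.smul_apply, smul_eq_mul]
      rw [h.measure_eq_sum hK hμ hp hH, Finset.mul_sum]
      exact Finset.sum_congr rfl fun i _ => mul_left_comm _ _ _
    · intro H hH
      have hpre : ∀ i, MeasurableSet (φ i ⁻¹' H) := fun i =>
        (Dilation.toContinuous (φ i)).measurable hH
      have hU : H ∩ K = ⋃ i, φ i '' (φ i ⁻¹' H ∩ K) := by
        ext x
        simp only [mem_iUnion]
        constructor
        · rintro ⟨hxH, hxK⟩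
          obtain ⟨i, y, hy, rfl⟩ := h.exists_preimage hxK
          exact ⟨i, y, ⟨hxH, hy⟩, rfl⟩
        · rintro ⟨i, y, ⟨hyH, hyK⟩, rfl⟩
          exact ⟨hyH, h.mapsTo i hyK⟩
      rw [hcomap H hH, hU, image_iUnion, measure_iUnion, tsum_fintype]
      · refine Finset.sum_congr rfl fun i _ => ?_
        rw [hcomap _ (hpre i), hcomm i _ ((hpre i).inter hK.measurableSet) inter_subset_right]
      · intro i j hij
        refine (disjoint_image_iff (Dilation.injective f)).2 ((h.disjoint hij).mono ?_ ?_) <;>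
          exact image_mono inter_subset_right
      · exact fun i => (hme f).measurableSet_image.2 ((hme (φ i)).measurableSet_image.2
          ((hpre i).inter hK.measurableSet))
  rw [← hcomap H hH, heq, Measure.smul_apply, smul_eq_mul]

/-- An isometry invariant measure which is self-similar for one presentation is self-similar for
every presentation. -/
theorem isSelfSimilarMeasure_of_isIsometryInvariantOn {s : ℕ}
    {ψ : Fin s → (EuclideanSpace ℝ (Fin d) →ᵈ EuclideanSpace ℝ (Fin d))} (h : IsPresentation K φ)
    (hψ : IsPresentation K ψ) (hK : IsCompact K) (hne : K.Nonempty)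
    {μ : Measure (EuclideanSpace ℝ (Fin d))} (hinv : IsIsometryInvariantOn K μ)
    (hμ : IsSelfSimilarMeasure K φ μ) : IsSelfSimilarMeasure K ψ μ := by
  obtain ⟨hμ1, hμ0, p, hp0, -, hp⟩ := hμ
  have : IsProbabilityMeasure μ := ⟨hμ1⟩
  have hme := fun j => (Dilation.isClosedEmbedding (ψ j)).measurableEmbedding
  have hsum : ∀ H, MeasurableSet H → H ⊆ K → μ H = ∑ j, μ (ψ j '' K) * μ (ψ j ⁻¹' H) := by
    intro H hH hHK
    have hpre : ∀ j, MeasurableSet (ψ j ⁻¹' H) := fun j =>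
      (Dilation.toContinuous (ψ j)).measurable hH
    have hU : H = ⋃ j, ψ j '' (ψ j ⁻¹' H ∩ K) := by
      ext x
      simp only [mem_iUnion]
      constructor
      · intro hx
        obtain ⟨j, y, hy, rfl⟩ := hψ.exists_preimage (hHK hx)
        exact ⟨j, y, ⟨hx, hy⟩, rfl⟩
      · rintro ⟨j, y, ⟨hyH, hyK⟩, rfl⟩
        exact hyH
    calc μ H = μ (⋃ j, ψ j '' (ψ j ⁻¹' H ∩ K)) := by rw [← hU]
      _ = ∑ j, μ (ψ j '' (ψ j ⁻¹' H ∩ K)) := by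
        rw [measure_iUnion, tsum_fintype]
        · intro i j hij
          exact (hψ.disjoint hij).mono (image_mono inter_subset_right)
            (image_mono inter_subset_right)
        · exact fun j => (hme j).measurableSet_image.2 ((hpre j).inter hK.measurableSet)
      _ = _ := Finset.sum_congr rfl fun j _ =>
        h.measure_image_of_isIsometryInvariantOn hK hne hinv hμ1 hμ0 hp (ψ j) (hψ.mapsTo j)
          (hpre j)
  have hcoe : ∀ j, ((μ (ψ j '' K)).toNNReal : ℝ≥0∞) = μ (ψ j '' K) := fun j =>
    ENNReal.coe_toNNReal (measure_ne_top _ _)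
  have hμK : μ K = 1 := by
    rw [← hμ1, ← measure_add_measure_compl (μ := μ) hK.measurableSet, hμ0, add_zero]
  refine ⟨hμ1, hμ0, fun j => (μ (ψ j '' K)).toNNReal, fun j => ?_, ?_, fun H hH hHK => ?_⟩
  -- A small ball about a point of `ψ j '' K` meets `K` only inside that piece.
  · obtain ⟨δ, hδ, hsep⟩ := hψ.exists_separation hK
    obtain ⟨a, ha, ha1, hφa⟩ := h.exists_ratio_le hK hne
    obtain ⟨x, hx⟩ := hne
    have hpow : Tendsto (fun n : ℕ => a ^ n * Metric.diam K) atTop (𝓝 0) := by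
      simpa using (tendsto_pow_atTop_nhds_zero_of_lt_one ha.le ha1).mul_const (Metric.diam K)
    obtain ⟨n, hn⟩ := (hpow.eventually_lt_const hδ).exists
    have hpos := h.measure_closedBall_pos hK hμ0 (by simp) hp0
      (fun H hH => h.measure_eq_sum hK hμ0 hp hH) hφa n (ψ j x) (hψ.mapsTo j hx)
    refine ENNReal.toNNReal_pos (ne_of_gt ?_) (measure_ne_top _ _)
    rw [← measure_inter_conull' (t := K) (measure_mono_null (fun x hx => hx.2) hμ0)] at hpos
    refine hpos.trans_le (measure_mono fun y hy => hsep j _ (mem_image_of_mem _ hx) y hy.2 ?_)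
    rw [dist_comm]
    exact (mem_closedBall.1 hy.1).trans_lt hn
  · rw [← ENNReal.coe_inj, ENNReal.ofNNReal_finsetSum, ENNReal.coe_one]
    have := hsum K hK.measurableSet subset_rfl
    rw [hμK] at this
    rw [this]
    refine Finset.sum_congr rfl fun j _ => ?_
    have hsub : μ (ψ j ⁻¹' K) = 1 :=
      le_antisymm prob_le_one (hμK ▸ measure_mono (hψ.mapsTo j))
    rw [hcoe, hsub, mul_one]
  · simpa only [hcoe] using hsum H hH hHK

end IsPresentation

/-! ### Commensurability of the ratios -/

/-- A compact set has only finitely many subsets that are separated from their complement by a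
given distance. -/
theorem IsCompact.finite_setOf_separated {X : Type*} [PseudoMetricSpace X] {K : Set X}
    (hK : IsCompact K) {η : ℝ} (hη : 0 < η) :
    {B : Set X | B ⊆ K ∧ ∀ x ∈ B, ∀ y ∈ K, dist x y < η → y ∈ B}.Finite := by
  obtain ⟨t, -, ht, hcov⟩ := hK.finite_cover_balls (half_pos hη)
  -- A separated set is determined by which balls of a finite `η / 2`-cover it meets.
  refine Set.Finite.of_finite_image (f := fun B => {c ∈ t | (ball c (η / 2) ∩ B).Nonempty})
    (ht.finite_subsets.subset ?_) ?_
  · rintro _ ⟨B, -, rfl⟩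
    exact fun c hc => hc.1
  · have key : ∀ B C : Set X, B ⊆ K → (∀ x ∈ C, ∀ y ∈ K, dist x y < η → y ∈ C) →
        {c ∈ t | (ball c (η / 2) ∩ B).Nonempty} = {c ∈ t | (ball c (η / 2) ∩ C).Nonempty} →
        B ⊆ C := by
      intro B C hB hC heq x hx
      obtain ⟨c, hct, hxc⟩ := mem_iUnion₂.1 (hcov (hB hx))
      have : c ∈ {c ∈ t | (ball c (η / 2) ∩ B).Nonempty} := ⟨hct, x, hxc, hx⟩
      rw [heq] at this
      obtain ⟨-, y, hyc, hy⟩ := this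
      refine hC y hy x (hB hx) ?_
      have := dist_triangle_right y x c
      rw [mem_ball] at hxc hyc
      linarith
    exact fun B hB C hC heq => (key B C hB.1 hC.2 heq).antisymm (key C B hC.1 hB.2 heq.symm)

namespace IsPresentation

variable {d r : ℕ} {K : Set (EuclideanSpace ℝ (Fin d))}
  {φ : Fin r → (EuclideanSpace ℝ (Fin d) →ᵈ EuclideanSpace ℝ (Fin d))}

theorem mapsTo_of_mem_closure (h : IsPresentation K φ)
    {g : EuclideanSpace ℝ (Fin d) →ᵈ EuclideanSpace ℝ (Fin d)}
    (hg : g ∈ Submonoid.closure (range φ)) : MapsTo g K K := by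
  induction hg using Submonoid.closure_induction with
  | mem g hg =>
    obtain ⟨i, rfl⟩ := hg
    exact h.mapsTo i
  | one => exact mapsTo_id K
  | mul g g' _ _ hg hg' => exact hg.comp hg'

/-- A subset of `K` with more than one point is contained in a smallest cylinder. -/
theorem exists_minimal_cylinder (h : IsPresentation K φ) (hK : IsCompact K) (hne : K.Nonempty)
    {A : Set (EuclideanSpace ℝ (Fin d))} (hA : A ⊆ K) (hA0 : 0 < Metric.diam A) :
    ∃ g ∈ Submonoid.closure (range φ), A ⊆ g '' K ∧ ∀ i, ¬ A ⊆ (g * φ i) '' K := by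
  by_contra! hcon
  obtain ⟨a, ha, ha1, hφa⟩ := h.exists_ratio_le hK hne
  -- Without a minimal cylinder one could descend forever, trapping `A` in sets of diameter tending
  -- to zero.
  have key : ∀ n : ℕ, ∃ g ∈ Submonoid.closure (range φ),
      A ⊆ g '' K ∧ (Dilation.ratio g : ℝ) ≤ a ^ n := by
    intro n
    induction n with
    | zero => exact ⟨1, one_mem _, by simpa using hA, by simp⟩
    | succ n ih =>
      obtain ⟨g, hg, hAg, hr⟩ := ih
      obtain ⟨i, hi⟩ := hcon g hg hAg
      refine ⟨g * φ i, mul_mem hg (Submonoid.subset_closure ⟨i, rfl⟩), hi, ?_⟩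
      rw [Dilation.ratio_mul, NNReal.coe_mul, pow_succ]
      exact mul_le_mul hr (hφa i) (NNReal.coe_nonneg _) (by positivity)
  have hpow : Tendsto (fun n : ℕ => a ^ n * Metric.diam K) atTop (𝓝 0) := by
    simpa using (tendsto_pow_atTop_nhds_zero_of_lt_one ha.le ha1).mul_const (Metric.diam K)
  obtain ⟨n, hn⟩ := (hpow.eventually_lt_const hA0).exists
  obtain ⟨g, -, hAg, hr⟩ := key n
  have h1 := diam_mono hAg (hK.image (Dilation.toContinuous g)).isBounded
  rw [Dilation.diam_image] at h1
  have h2 := mul_le_mul_of_nonneg_right hr (diam_nonneg (s := K))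
  linarith

/-- The iterated pieces are separated from the rest of `K` by a distance comparable to their size. -/
theorem pow_separated (h : IsPresentation K φ) (hK : IsCompact K) (hne : K.Nonempty) {δ : ℝ}
    (hsep : ∀ i, ∀ x ∈ φ i '' K, ∀ y ∈ K, dist x y < δ → y ∈ φ i '' K) (i : Fin r) (n : ℕ) :
    ∀ x ∈ (φ i ^ n) '' K, ∀ y ∈ K, dist x y < Dilation.ratio (φ i) ^ n * δ →
      y ∈ (φ i ^ n) '' K := by
  induction n with
  | zero =>
    intro x _ y hy _
    exact ⟨y, hy, rfl⟩
  | succ n ih =>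
    rintro _ ⟨x, hx, rfl⟩ y hy hlt
    have hpos : (0 : ℝ) < Dilation.ratio (φ i) := Dilation.ratio_pos (φ i)
    have hle : (Dilation.ratio (φ i) : ℝ) ≤ 1 := (NNReal.coe_lt_one.2 (h.ratio_lt_one hK hne i)).le
    have hmem : ∀ z ∈ K, (φ i ^ n) z ∈ K := fun z hz =>
      h.mapsTo_of_mem_closure (pow_mem (Submonoid.subset_closure (mem_range_self i)) n) hz
    have hxe : (φ i ^ (n + 1)) x = φ i ((φ i ^ n) x) := by simp [pow_succ']
    have hδ : 0 < δ := by
      by_contra! hδ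
      exact absurd (dist_nonneg.trans_lt hlt) (not_lt.2 (mul_nonpos_of_nonneg_of_nonpos
        (by positivity) hδ))
    rw [hxe] at hlt
    obtain ⟨z, hz, rfl⟩ := hsep i _ (mem_image_of_mem _ (hmem x hx)) y hy
      (hlt.trans_le (mul_le_of_le_one_left hδ.le (pow_le_one₀ hpos.le hle)))
    rw [Dilation.dist_eq, pow_succ', mul_assoc] at hlt
    obtain ⟨w, hw, rfl⟩ := ih _ (mem_image_of_mem _ hx) z hz (lt_of_mul_lt_mul_left hlt hpos.le)
    exact ⟨w, hw, by simp [pow_succ']⟩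

theorem log_ratio_mem_span {g : EuclideanSpace ℝ (Fin d) →ᵈ EuclideanSpace ℝ (Fin d)}
    (hg : g ∈ Submonoid.closure (range φ)) :
    Real.log (Dilation.ratio g : ℝ) ∈
      Submodule.span ℚ (range fun i => -Real.log (Dilation.ratio (φ i) : ℝ)) := by
  induction hg using Submonoid.closure_induction with
  | mem g hg =>
    obtain ⟨i, rfl⟩ := hg
    exact neg_mem_iff.1 (Submodule.subset_span ⟨i, rfl⟩)
  | one => simp
  | mul g g' _ _ hg hg' =>
    rw [Dilation.ratio_mul, NNReal.coe_mul, Real.log_mul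
      (NNReal.coe_ne_zero.2 (Dilation.ratio_ne_zero g))
      (NNReal.coe_ne_zero.2 (Dilation.ratio_ne_zero g'))]
    exact add_mem hg hg'

/-- Every ratio of a presentation has a positive power which is a quotient of products of ratios of
any other presentation. -/
theorem exists_pow_ratio_mul_eq {s : ℕ}
    {ψ : Fin s → (EuclideanSpace ℝ (Fin d) →ᵈ EuclideanSpace ℝ (Fin d))} (h : IsPresentation K φ)
    (hψ : IsPresentation K ψ) (hK : IsCompact K) (hne : K.Nonempty) (j : Fin s) :
    ∃ k : ℕ, 0 < k ∧ ∃ g ∈ Submonoid.closure (range φ), ∃ g' ∈ Submonoid.closure (range φ),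
      Dilation.ratio (ψ j) ^ k * Dilation.ratio g = Dilation.ratio g' := by
  obtain ⟨δ, hδ, hsep⟩ := h.exists_separation hK
  obtain ⟨δ', hδ', hsep'⟩ := hψ.exists_separation hK
  have hD := h.diam_pos hK hne
  have hρ : (0 : ℝ) < Dilation.ratio (ψ j) := Dilation.ratio_pos (ψ j)
  have hmaps : ∀ n : ℕ, MapsTo (⇑(ψ j ^ n)) K K := fun n =>
    hψ.mapsTo_of_mem_closure (pow_mem (Submonoid.subset_closure (mem_range_self j)) n)
  have hdiam : ∀ n : ℕ, Metric.diam ((ψ j ^ n) '' K) = Dilation.ratio (ψ j) ^ n * Metric.diam K :=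
    fun n => by rw [Dilation.diam_image, Dilation.ratio_pow, NNReal.coe_pow]
  choose g hg hsub hmin using fun n => h.exists_minimal_cylinder hK hne
    (hmaps n).image_subset (by rw [hdiam]; positivity)
  let B : ℕ → Set (EuclideanSpace ℝ (Fin d)) := fun n => g n ⁻¹' ((ψ j ^ n) '' K)
  have hBK : ∀ n, B n ⊆ K := by
    intro n x hx
    obtain ⟨y, hy, hyx⟩ := hsub n hx
    exact Dilation.injective (g n) hyx ▸ hy
  have hgB : ∀ n, g n '' B n = (ψ j ^ n) '' K := fun n =>
    image_preimage_eq_of_subset ((hsub n).trans (image_subset_range _ _))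
  have hBdiam : ∀ n, Dilation.ratio (g n) * Metric.diam (B n) =
      Dilation.ratio (ψ j) ^ n * Metric.diam K := fun n => by
    rw [← Dilation.diam_image, hgB, hdiam]
  -- If smaller, `B n` would lie in a single piece of `K`, against minimality of `g n`.
  have hBδ : ∀ n, δ ≤ Metric.diam (B n) := by
    intro n
    by_contra! hlt
    obtain ⟨x, hx⟩ := hne
    obtain ⟨y, hy, -⟩ := (hgB n).symm.subset (mem_image_of_mem _ hx)
    obtain ⟨i, z, hz, rfl⟩ := h.exists_preimage (hBK n hy)
    refine hmin n i ?_
    rw [← hgB n, Dilation.coe_mul, image_comp]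
    exact image_mono fun w hw => hsep i _ (mem_image_of_mem _ hz) w (hBK n hw)
      ((dist_le_diam_of_mem (hK.isBounded.subset (hBK n)) hy hw).trans_lt hlt)
  -- `ψ j ^ n '' K` has gap `ratio (ψ j) ^ n * δ'`; dividing by `ratio (g n)` turns it into `diam (B
  -- n) * δ' / diam K`, which is at least the constant here.
  have hBsep : ∀ n, ∀ x ∈ B n, ∀ y ∈ K, dist x y < δ * δ' / Metric.diam K → y ∈ B n := by
    intro n x hx y hy hlt
    refine hψ.pow_separated hK hne hsep' j n _ hx _ (h.mapsTo_of_mem_closure (hg n) hy) ?_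
    have hgp : (0 : ℝ) < Dilation.ratio (g n) := Dilation.ratio_pos (g n)
    rw [Dilation.dist_eq]
    calc Dilation.ratio (g n) * dist x y
        < Dilation.ratio (g n) * (δ * δ' / Metric.diam K) := by gcongr
      _ ≤ Dilation.ratio (g n) * (Metric.diam (B n) * δ' / Metric.diam K) := by
        gcongr
        exact hBδ n
      _ = Dilation.ratio (g n) * Metric.diam (B n) * δ' / Metric.diam K := by ring
      _ = Dilation.ratio (ψ j) ^ n * δ' := by
        rw [hBdiam]
        field_simp
  have hη : 0 < δ * δ' / Metric.diam K := by positivity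
  obtain ⟨m, n, hmn, hBmn⟩ := Set.Finite.exists_lt_map_eq_of_forall_mem
    (fun n => show B n ∈ {B | B ⊆ K ∧ ∀ x ∈ B, ∀ y ∈ K, dist x y < δ * δ' / Metric.diam K → y ∈ B}
      from ⟨hBK n, hBsep n⟩) (hK.finite_setOf_separated hη)
  refine ⟨n - m, by omega, g m, hg m, g n, hg n, NNReal.coe_injective ?_⟩
  have hBpos : 0 < Metric.diam (B n) := hδ.trans_le (hBδ n)
  refine mul_right_cancel₀ hBpos.ne' ?_
  rw [NNReal.coe_mul, NNReal.coe_pow, mul_assoc, hBdiam n, ← hBmn, hBdiam m, ← mul_assoc,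
    ← pow_add, Nat.sub_add_cancel hmn.le]

theorem span_log_ratio_le {s : ℕ}
    {ψ : Fin s → (EuclideanSpace ℝ (Fin d) →ᵈ EuclideanSpace ℝ (Fin d))} (h : IsPresentation K φ)
    (hψ : IsPresentation K ψ) (hK : IsCompact K) (hne : K.Nonempty) :
    Submodule.span ℚ (range fun j => -Real.log (Dilation.ratio (ψ j) : ℝ)) ≤
      Submodule.span ℚ (range fun i => -Real.log (Dilation.ratio (φ i) : ℝ)) := by
  rw [Submodule.span_le]
  rintro _ ⟨j, rfl⟩
  obtain ⟨k, hk, g, hg, g', hg', heq⟩ := h.exists_pow_ratio_mul_eq hψ hK hne j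
  refine neg_mem ?_
  have hlog := congrArg (fun x : ℝ≥0 => Real.log (x : ℝ)) heq
  simp only [NNReal.coe_mul, NNReal.coe_pow] at hlog
  rw [Real.log_mul (pow_ne_zero _ (NNReal.coe_ne_zero.2 (Dilation.ratio_ne_zero _)))
    (NNReal.coe_ne_zero.2 (Dilation.ratio_ne_zero _)), Real.log_pow] at hlog
  -- Division by the exponent `k` is where rational coefficients are needed.
  have hmem := Submodule.smul_mem _ ((k : ℚ)⁻¹)
    (sub_mem (log_ratio_mem_span hg') (log_ratio_mem_span hg))
  rw [← hlog, add_sub_cancel_right, Rat.smul_def] at hmem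
  convert hmem using 1
  push_cast
  have : (k : ℝ) ≠ 0 := by exact_mod_cast hk.ne'
  field_simp

theorem algebraicDependenceNumber_eq {s : ℕ}
    {ψ : Fin s → (EuclideanSpace ℝ (Fin d) →ᵈ EuclideanSpace ℝ (Fin d))} (h : IsPresentation K φ)
    (hψ : IsPresentation K ψ) (hK : IsCompact K) (hne : K.Nonempty) :
    algebraicDependenceNumber φ = algebraicDependenceNumber ψ := by
  rw [algebraicDependenceNumber, algebraicDependenceNumber,
    (hψ.span_log_ratio_le h hK hne).antisymm (h.span_log_ratio_le hψ hK hne)]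

end IsPresentation

theorem theorem5p4 (d : ℕ) (K : Set (EuclideanSpace ℝ (Fin d))) (hK : IsCompact K)
    (hne : K.Nonempty) (r s : ℕ)
    (φ : Fin r → (EuclideanSpace ℝ (Fin d) →ᵈ EuclideanSpace ℝ (Fin d)))
    (ψ : Fin s → (EuclideanSpace ℝ (Fin d) →ᵈ EuclideanSpace ℝ (Fin d)))
    (hφ : IsPresentation K φ) (hψ : IsPresentation K ψ) :
    (∀ μ : Measure (EuclideanSpace ℝ (Fin d)),
      IsIsometryInvariantOn K μ → IsSelfSimilarMeasure K φ μ → IsSelfSimilarMeasure K ψ μ) ∧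
    {μ : Measure (EuclideanSpace ℝ (Fin d)) |
        IsIsometryInvariantOn K μ ∧ IsSelfSimilarMeasure K φ μ} =
      {μ : Measure (EuclideanSpace ℝ (Fin d)) |
        IsIsometryInvariantOn K μ ∧ IsSelfSimilarMeasure K ψ μ} ∧
    algebraicDependenceNumber φ = algebraicDependenceNumber ψ := by
  have hφψ : ∀ μ : Measure (EuclideanSpace ℝ (Fin d)),
      IsIsometryInvariantOn K μ → IsSelfSimilarMeasure K φ μ → IsSelfSimilarMeasure K ψ μ :=
    fun _ hinv hμ => hφ.isSelfSimilarMeasure_of_isIsometryInvariantOn hψ hK hne hinv hμ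
  have hψφ : ∀ μ : Measure (EuclideanSpace ℝ (Fin d)),
      IsIsometryInvariantOn K μ → IsSelfSimilarMeasure K ψ μ → IsSelfSimilarMeasure K φ μ :=
    fun _ hinv hμ => hψ.isSelfSimilarMeasure_of_isIsometryInvariantOn hφ hK hne hinv hμ
  exact ⟨hφψ, Set.ext fun μ => ⟨fun hμ => ⟨hμ.1, hφψ μ hμ.1 hμ.2⟩,
    fun hμ => ⟨hμ.1, hψφ μ hμ.1 hμ.2⟩⟩, hφ.algebraicDependenceNumber_eq hψ hK hne⟩
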